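/- Let $n\ge 0$, $\theta_0\in\mathbb R^n$, $\sigma>0$, and observe $Y=\theta_0+Z$ with $Z\sim N(0,\sigma^2I_n)$. Let $S$ be a finite nonempty set and, for each $s\in S$, let $H_s\in\mathbb R^{n\times n}$ be an orthogonal projection matrix. Put $\hat\theta_s(Y)=H_sY$, write $\mathrm{Risk}(\hat\theta)=\mathbb E\|\hat\theta(Y)-\theta_0\|_2^2$ for any estimator $\hat\theta$ and $R(s)=\mathrm{Risk}(\hat\theta_s)$, let $s_0\in\operatorname{argmin}_{s\in S}R(s)$, and let $\hat s(Y)$ be a (measurable) minimizer over $s\in S$ of $\mathrm{SURE}(s)=\|Y-H_sY\|_2^2+2\sigma^2\operatorname{tr}(H_s)$. The SURE-tuned estimator is $\hat\theta_{\hat s}(Y)=H_{\hat s(Y)}Y$. Let $\log_+t=\max\{0,\log t\}$ for $t>0$. (i) There is a numerical constant $C>0$ such that in every such setting all the risks involved are finite and $$\mathrm{Risk}(\hat\theta_{\hat s})\le R(s_0)+C\left(\sqrt{R(s_0)\,\sigma^2\log|S|}+\sigma^2\log|S|\left(1+\log_+\frac{\sigma^2\log|S|}{R(s_0)}\right)\right),$$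 where the $\log_+$ term is read as $0$ if $|S|=1$ or $R(s_0)=0$. (ii) For every $c>0$ there is a constant $C>0$, depending only on $c$, such that in every such setting with $\min_{s\in S}\mathrm{Risk}(\hat\theta_s)\ge c\,\sigma^2\log|S|$ and for all $\eta>0$, $$\mathrm{Risk}(\hat\theta_{\hat s})\le(1+C\eta)\min_{s\in S}\mathrm{Risk}(\hat\theta_s)+C\,\frac{\sigma^2\log|S|}{\eta}.$$ -/

import Mathlib

open MeasureTheory ProbabilityTheory

noncomputable section

/-- The law `N(θ₀, σ² Iₙ)` of the observation `Y = θ₀ + Z`, `Z ∼ N(0, σ² Iₙ)`, in the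
Gaussian sequence model. -/
def gaussianSequenceLaw {n : ℕ} (θ₀ : EuclideanSpace ℝ (Fin n)) (σ : ℝ) :
    Measure (EuclideanSpace ℝ (Fin n)) :=
  multivariateGaussian θ₀ (σ ^ 2 • (1 : Matrix (Fin n) (Fin n) ℝ))

/-- The risk `E ‖θ̂(Y) - θ₀‖₂²` of an estimator `θ̂ : ℝⁿ → ℝⁿ` under `Y ∼ N(θ₀, σ² Iₙ)`. -/
def risk {n : ℕ} (θ₀ : EuclideanSpace ℝ (Fin n)) (σ : ℝ)
    (est : EuclideanSpace ℝ (Fin n) → EuclideanSpace ℝ (Fin n)) : ℝ :=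
  ∫ y, ‖est y - θ₀‖ ^ 2 ∂(gaussianSequenceLaw θ₀ σ)

/-- The squared error of `θ̂` is integrable, so that `risk` is its genuine expectation. -/
def HasFiniteRisk {n : ℕ} (θ₀ : EuclideanSpace ℝ (Fin n)) (σ : ℝ)
    (est : EuclideanSpace ℝ (Fin n) → EuclideanSpace ℝ (Fin n)) : Prop :=
  Integrable (fun y => ‖est y - θ₀‖ ^ 2) (gaussianSequenceLaw θ₀ σ)

/-- The linear smoother `y ↦ H y`. -/
def linearEstimator {n : ℕ} (H : Matrix (Fin n) (Fin n) ℝ) (y : EuclideanSpace ℝ (Fin n)) :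
    EuclideanSpace ℝ (Fin n) :=
  Matrix.toEuclideanLin H y

/-- Stein's unbiased risk estimate `‖y - H y‖₂² + 2 σ² tr H` of the smoother `H` at the data `y`. -/
def sure {n : ℕ} (σ : ℝ) (H : Matrix (Fin n) (Fin n) ℝ) (y : EuclideanSpace ℝ (Fin n)) : ℝ :=
  ‖y - linearEstimator H y‖ ^ 2 + 2 * σ ^ 2 * H.trace

/-- `sel` is a (measurable) choice `ŝ(y) ∈ argmin_{s ∈ S} SURE(s)`. -/
structure IsSureMinimizer {n : ℕ} {S : Type*} (σ : ℝ) (H : S → Matrix (Fin n) (Fin n) ℝ)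
    (sel : EuclideanSpace ℝ (Fin n) → S) : Prop where
  measurableSet_preimage : ∀ s, MeasurableSet (sel ⁻¹' {s})
  sure_le : ∀ y s, sure σ (H (sel y)) y ≤ sure σ (H s) y

/-- The tuned estimator `y ↦ H_{ŝ(y)} y`. -/
def tunedEstimator {n : ℕ} {S : Type*} (H : S → Matrix (Fin n) (Fin n) ℝ)
    (sel : EuclideanSpace ℝ (Fin n) → S) (y : EuclideanSpace ℝ (Fin n)) :
    EuclideanSpace ℝ (Fin n) :=
  linearEstimator (H (sel y)) y

end

/-!
Write `y = θ + σ z` with `z` standard Gaussian. For an orthogonal projection `H` with bias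
`b = θ - H θ`, put `R = ‖b‖² + σ² tr H`, `D = ‖H z‖² - tr H` and `G = ⟪b, z⟫`. Since `b` is
orthogonal to the range of `H`, the loss of `H y` is `R + σ² D` (`norm_linearEstimator_sub_sq`) and
its SURE is `R + 2 σ G - σ² D + σ² ‖z‖²` (`sure_add_smul`). As `D` and `G` are centred, `R` is the
risk of `H y`, and taking expectations in the inequality `SURE(ŝ) ≤ SURE(s₀)` gives
`E R(ŝ) ≤ R(s₀) + σ² E D(ŝ) - 2 σ E G(ŝ)`.

The fluctuations at the random index `ŝ` are controlled by their exponential moments: with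
`L = log |S|`, if `E exp (X s) ≤ 1` for every `s`, then `E X(ŝ) ≤ L`
(`integral_comp_sel_le_log_card`). The variable `G` is Gaussian with variance `‖b‖²`, and in an
eigenbasis of `H` the variable `D` is a centred chi-squared with `tr H` degrees of freedom, so that
`E exp (t D) ≤ exp (2 t² tr H)` for `|t| ≤ 1 / 4` (`exp_norm_sq_sub_trace_bound`). Hence both
fluctuations have expectation at most of order `t E R(ŝ) + σ² L / t`. The first term is absorbed,
and the risk of the tuned estimator is at most `(1 + 8 t) R(s₀) + 10 σ² L / t` for every
`0 < t ≤ 1 / 4` (`risk_tunedEstimator_le`).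

Part (i) follows by optimizing over `t`, and the logarithmic factor in its statement is then only
bounded below by `1`. Part (ii) follows with `t = min η (1 / 4)`; the lower bound on the oracle risk
serves to absorb `σ² L` when `η > 1 / 4`.
-/

/-! ### Exponential moments of a centred chi-squared variable -/

/-- This is `-log (1 - u) ≤ u + u²`; at `u = 2 * s` it bounds the log-Laplace transform
`-s - log (1 - 2 * s) / 2` of `g² - 1`, `g ∼ N(0, 1)`, by `2 * s²`. -/
lemma one_le_exp_mul_one_sub {u : ℝ} (h : |u| ≤ 1 / 2) : 1 ≤ Real.exp (u + u ^ 2) * (1 - u) := by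
  obtain ⟨h1, h2⟩ := abs_le.1 h
  rcases le_total 0 u with hu | hu
  · have h3 : 1 + (u + u ^ 2) + (u + u ^ 2) ^ 2 / 2 ≤ Real.exp (u + u ^ 2) :=
      Real.quadratic_le_exp_of_nonneg (by positivity)
    have h4 := mul_le_mul_of_nonneg_right h3 (by linarith : 0 ≤ 1 - u)
    have h5 : 0 ≤ u ^ 2 * (1 / 2 - u) := mul_nonneg (sq_nonneg u) (by linarith)
    have h6 : 0 ≤ u ^ 3 * (1 / 2 - u) := mul_nonneg (by positivity) (by linarith)
    nlinarith [pow_nonneg hu 4, pow_nonneg hu 3]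
  · have h3 := Real.add_one_le_exp (u + u ^ 2)
    have h4 := mul_le_mul_of_nonneg_right h3 (by linarith : 0 ≤ 1 - u)
    nlinarith [mul_nonneg (sq_nonneg u) (neg_nonneg.2 hu)]

lemma exp_mul_sq_sub_one_mul_gaussianPDFReal (s x : ℝ) :
    gaussianPDFReal 0 1 x * Real.exp (s * (x ^ 2 - 1)) =
      (√(2 * Real.pi))⁻¹ * Real.exp (-s) * Real.exp (-(1 / 2 - s) * x ^ 2) := by
  simp only [gaussianPDFReal, NNReal.coe_one, mul_one, sub_zero]
  rw [mul_assoc, mul_assoc, ← Real.exp_add, ← Real.exp_add]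
  congr 2
  ring

lemma integrable_exp_mul_sq_sub_one_gaussianReal {s : ℝ} (hs : s < 1 / 2) :
    Integrable (fun x : ℝ ↦ Real.exp (s * (x ^ 2 - 1))) (gaussianReal 0 1) := by
  rw [gaussianReal_of_var_ne_zero _ one_ne_zero,
    integrable_withDensity_iff_integrable_smul' (measurable_gaussianPDF _ _)
      (ae_of_all _ fun _ ↦ gaussianPDF_lt_top)]
  simp only [toReal_gaussianPDF, smul_eq_mul, exp_mul_sq_sub_one_mul_gaussianPDFReal]
  exact (integrable_exp_neg_mul_sq (by linarith)).const_mul _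

lemma integral_exp_mul_sq_sub_one_gaussianReal_le {s : ℝ} (hs : |s| ≤ 1 / 4) :
    ∫ x : ℝ, Real.exp (s * (x ^ 2 - 1)) ∂gaussianReal 0 1 ≤ Real.exp (2 * s ^ 2) := by
  have hs' : 0 < 1 - 2 * s := by linarith [(abs_le.1 hs).2]
  have key : 1 ≤ Real.exp (2 * s + (2 * s) ^ 2) * (1 - 2 * s) :=
    one_le_exp_mul_one_sub (by rw [abs_mul, abs_two]; linarith)
  have hsq : (√(2 * Real.pi))⁻¹ * √(Real.pi / (1 / 2 - s)) = (√(1 - 2 * s))⁻¹ := by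
    rw [← Real.sqrt_inv, ← Real.sqrt_inv, ← Real.sqrt_mul (by positivity)]
    have : (1 / 2 - s) ≠ 0 := by linarith
    congr 1
    field_simp
  rw [integral_gaussianReal_eq_integral_smul one_ne_zero]
  simp only [smul_eq_mul, exp_mul_sq_sub_one_mul_gaussianPDFReal]
  rw [integral_const_mul, integral_gaussian, mul_right_comm, hsq, inv_mul_le_iff₀ (by positivity),
    ← abs_of_pos (Real.exp_pos (-s)), ← Real.sqrt_sq_eq_abs,
    ← abs_of_pos (Real.exp_pos (2 * s ^ 2)), ← Real.sqrt_sq_eq_abs, ← Real.sqrt_mul hs'.le]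
  apply Real.sqrt_le_sqrt
  have e1 : Real.exp (-s) ^ 2 = Real.exp (-(2 * s)) := by
    rw [← Real.exp_nat_mul]; congr 1; push_cast; ring
  have e2 : Real.exp (2 * s ^ 2) ^ 2 =
      Real.exp (-(2 * s)) * Real.exp (2 * s + (2 * s) ^ 2) := by
    rw [← Real.exp_nat_mul, ← Real.exp_add]; congr 1; push_cast; ring
  rw [e1, e2]
  nlinarith [mul_le_mul_of_nonneg_left key (Real.exp_pos (-(2 * s))).le]

lemma integrable_sq_sub_one_gaussianReal :
    Integrable (fun x : ℝ ↦ x ^ 2 - 1) (gaussianReal 0 1) :=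
  ((memLp_id_gaussianReal 2).integrable_sq).sub (integrable_const 1)

lemma integral_sq_sub_one_gaussianReal : ∫ x : ℝ, (x ^ 2 - 1) ∂gaussianReal 0 1 = 0 := by
  have h := variance_of_integral_eq_zero (X := fun x : ℝ ↦ x) (μ := gaussianReal 0 1)
    (by fun_prop) integral_id_gaussianReal
  rw [variance_fun_id_gaussianReal] at h
  have hsq : Integrable (fun x : ℝ ↦ x ^ 2) (gaussianReal 0 1) :=
    (memLp_id_gaussianReal 2).integrable_sq
  rw [integral_sub hsq (integrable_const 1), ← h]
  simp

/-! ### Expectation at a data-dependent index -/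

section Selection

variable {Ω S : Type*} [MeasurableSpace Ω] {P : Measure Ω} [Fintype S] {X : S → Ω → ℝ}
  {sel : Ω → S}

lemma integrable_comp_sel (hsel : ∀ s, MeasurableSet (sel ⁻¹' {s}))
    (hX : ∀ s, Integrable (X s) P) : Integrable (fun ω ↦ X (sel ω) ω) P := by
  classical
  have h : (fun ω ↦ X (sel ω) ω) = fun ω ↦ ∑ s, (sel ⁻¹' {s}).indicator (X s) ω := by
    ext ω
    simp [Set.indicator_apply]
  rw [h]
  exact integrable_finsetSum _ fun s _ ↦ (hX s).indicator (hsel s)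

/-- The maximal inequality behind the `log |S|` terms. Instead of Jensen's inequality for `log`,
the proof integrates the tangent bound `x ≤ log N - 1 + exp x / N` at `x = X (sel ω) ω`, where
`N = |S|`. -/
lemma integral_comp_sel_le_log_card [IsProbabilityMeasure P] [Nonempty S]
    (hsel : ∀ s, MeasurableSet (sel ⁻¹' {s}))
    (hX : ∀ s, Integrable (X s) P) (hint : ∀ s, Integrable (fun ω ↦ Real.exp (X s ω)) P)
    (hexp : ∀ s, ∫ ω, Real.exp (X s ω) ∂P ≤ 1) :
    ∫ ω, X (sel ω) ω ∂P ≤ Real.log (Fintype.card S) := by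
  have hcard : (0 : ℝ) < Fintype.card S := by exact_mod_cast Fintype.card_pos
  have hsum : Integrable (fun ω ↦ (∑ s, Real.exp (X s ω)) / Fintype.card S) P :=
    (integrable_finsetSum _ fun s _ ↦ hint s).div_const _
  calc ∫ ω, X (sel ω) ω ∂P
      ≤ ∫ ω, ((Real.log (Fintype.card S) - 1) + (∑ s, Real.exp (X s ω)) / Fintype.card S) ∂P := by
        refine integral_mono (integrable_comp_sel hsel hX) ((integrable_const _).add hsum)
          fun ω ↦ ?_
        have h1 := Real.add_one_le_exp (X (sel ω) ω - Real.log (Fintype.card S))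
        rw [Real.exp_sub, Real.exp_log hcard] at h1
        have h2 : Real.exp (X (sel ω) ω) / Fintype.card S ≤
            (∑ s, Real.exp (X s ω)) / Fintype.card S := by
          gcongr
          exact Finset.single_le_sum (f := fun s ↦ Real.exp (X s ω))
            (fun s _ ↦ (Real.exp_pos _).le) (Finset.mem_univ (sel ω))
        simp only
        linarith
    _ = (Real.log (Fintype.card S) - 1) +
          (∑ s, ∫ ω, Real.exp (X s ω) ∂P) / Fintype.card S := by
        rw [integral_add (integrable_const _) hsum, integral_div,
          integral_finsetSum _ fun s _ ↦ hint s]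
        simp
    _ ≤ (Real.log (Fintype.card S) - 1) + (∑ _s : S, (1 : ℝ)) / Fintype.card S := by
        gcongr with s
        exact hexp s
    _ = Real.log (Fintype.card S) := by
        simp [hcard.ne']

end Selection

/-! ### Projections of a standard Gaussian vector -/

section Projection

variable {n : ℕ} {H : Matrix (Fin n) (Fin n) ℝ}

open scoped MatrixOrder in
lemma gaussianSequenceLaw_eq_map (θ : EuclideanSpace ℝ (Fin n)) {σ : ℝ} (hσ : 0 < σ) :
    gaussianSequenceLaw θ σ =
      (stdGaussian (EuclideanSpace ℝ (Fin n))).map (fun z ↦ θ + σ • z) := by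
  have h : CFC.sqrt (σ ^ 2 • (1 : Matrix (Fin n) (Fin n) ℝ)) = σ • 1 := by
    rw [CFC.sqrt_eq_iff _ _ ?_ ?_]
    · simp [smul_smul, sq]
    · exact (Matrix.PosSemidef.one.smul (by positivity)).nonneg
    · exact (Matrix.PosSemidef.one.smul hσ.le).nonneg
  simp [gaussianSequenceLaw, multivariateGaussian, h]

lemma isSymmetric_toEuclideanLin (hH : IsStarProjection H) :
    (Matrix.toEuclideanLin H).IsSymmetric :=
  Matrix.isSymmetric_toEuclideanLin_iff.2 hH.isSelfAdjoint

lemma toEuclideanLin_idem (hH : IsStarProjection H) (x : EuclideanSpace ℝ (Fin n)) :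
    Matrix.toEuclideanLin H (Matrix.toEuclideanLin H x) = Matrix.toEuclideanLin H x := by
  have h := hH.isIdempotentElem.eq
  simp [Matrix.toLpLin_apply, h]

/-- In an orthonormal eigenbasis `u` of an orthogonal projection `H`, with eigenvalues
`a i ∈ {0, 1}`, the centred quadratic form `‖H z‖² - tr H` is a sum of functions of the single
coordinates of `z`, which are independent when `z` is standard Gaussian. -/
lemma exists_eigenbasis (hH : IsStarProjection H) :
    ∃ (u : OrthonormalBasis (Fin n) ℝ (EuclideanSpace ℝ (Fin n))) (a : Fin n → ℝ),
      (∀ i, a i = 0 ∨ a i = 1) ∧ H.trace = ∑ i, a i ∧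
      ∀ x : Fin n → ℝ, ‖Matrix.toEuclideanLin H (∑ i, x i • u i)‖ ^ 2 - H.trace =
        ∑ i, a i * (x i ^ 2 - 1) := by
  have hh : H.IsHermitian := hH.isSelfAdjoint
  have hu : ∀ i, Matrix.toEuclideanLin H (hh.eigenvectorBasis i) =
      hh.eigenvalues i • hh.eigenvectorBasis i := fun i ↦ by
    rw [Matrix.toLpLin_apply, hh.mulVec_eigenvectorBasis]; rfl
  have ha : ∀ i, hh.eigenvalues i * hh.eigenvalues i = hh.eigenvalues i := fun i ↦ by
    have h := toEuclideanLin_idem hH (hh.eigenvectorBasis i)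
    rw [hu, map_smul, hu, smul_smul] at h
    exact smul_left_injective ℝ (hh.eigenvectorBasis.orthonormal.ne_zero i) h
  have htr : H.trace = ∑ i, hh.eigenvalues i := by simpa using hh.trace_eq_sum_eigenvalues
  refine ⟨hh.eigenvectorBasis, hh.eigenvalues, fun i ↦ ?_, htr, fun x ↦ ?_⟩
  · have : hh.eigenvalues i * (hh.eigenvalues i - 1) = 0 := by linear_combination ha i
    rcases mul_eq_zero.1 this with h | h
    · exact .inl h
    · exact .inr (by linarith)
  · have h1 : Matrix.toEuclideanLin H (∑ i, x i • hh.eigenvectorBasis i) =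
        ∑ i, (x i * hh.eigenvalues i) • hh.eigenvectorBasis i := by
      simp [hu, smul_smul]
    rw [h1, ← real_inner_self_eq_norm_sq, hh.eigenvectorBasis.orthonormal.inner_sum, htr,
      ← Finset.sum_sub_distrib]
    refine Finset.sum_congr rfl fun i _ ↦ ?_
    simp only [conj_trivial]
    linear_combination (x i ^ 2) * ha i

lemma trace_nonneg_of_isStarProjection (hH : IsStarProjection H) : 0 ≤ H.trace := by
  obtain ⟨u, a, ha, htr, -⟩ := exists_eigenbasis hH
  rw [htr]
  exact Finset.sum_nonneg fun i _ ↦ by rcases ha i with h | h <;> simp [h]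

lemma measurable_norm_sq_sub_trace :
    Measurable (fun z : EuclideanSpace ℝ (Fin n) ↦
      ‖Matrix.toEuclideanLin H z‖ ^ 2 - H.trace) := by
  have : Continuous (Matrix.toEuclideanLin H) := LinearMap.continuous_of_finiteDimensional _
  fun_prop

lemma integrable_norm_sq_sub_trace (hH : IsStarProjection H) :
    Integrable (fun z : EuclideanSpace ℝ (Fin n) ↦ ‖Matrix.toEuclideanLin H z‖ ^ 2 - H.trace)
      (stdGaussian _) := by
  obtain ⟨u, a, -, -, hD⟩ := exists_eigenbasis hH
  rw [stdGaussian_eq_map_pi_orthonormalBasis u, integrable_map_measure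
    measurable_norm_sq_sub_trace.aestronglyMeasurable
    (Measurable.aemeasurable (by fun_prop))]
  simp only [Function.comp_def, hD]
  exact integrable_finsetSum _ fun i _ ↦ (integrable_comp_eval
    (μ := fun _ : Fin n ↦ gaussianReal 0 1) (i := i) integrable_sq_sub_one_gaussianReal).const_mul _

lemma integral_norm_sq_sub_trace (hH : IsStarProjection H) :
    ∫ z : EuclideanSpace ℝ (Fin n), (‖Matrix.toEuclideanLin H z‖ ^ 2 - H.trace)
      ∂(stdGaussian _) = 0 := by
  obtain ⟨u, a, -, -, hD⟩ := exists_eigenbasis hH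
  rw [stdGaussian_eq_map_pi_orthonormalBasis u, integral_map
    (Measurable.aemeasurable (by fun_prop))
    measurable_norm_sq_sub_trace.aestronglyMeasurable]
  simp only [hD]
  rw [integral_finsetSum _ fun i _ ↦ (integrable_comp_eval
    (μ := fun _ : Fin n ↦ gaussianReal 0 1) (i := i)
      integrable_sq_sub_one_gaussianReal).const_mul _]
  refine Finset.sum_eq_zero fun i _ ↦ ?_
  rw [integral_const_mul, integral_comp_eval (μ := fun _ : Fin n ↦ gaussianReal 0 1) (i := i)
    (f := fun x : ℝ ↦ x ^ 2 - 1) (by fun_prop), integral_sq_sub_one_gaussianReal, mul_zero]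

/-- `‖H z‖² - tr H` is sub-gamma with variance proxy proportional to `tr H`, on a range of `t` that
does not depend on `H`. -/
lemma exp_norm_sq_sub_trace_bound (hH : IsStarProjection H) {t : ℝ} (ht : |t| ≤ 1 / 4) :
    Integrable (fun z : EuclideanSpace ℝ (Fin n) ↦
      Real.exp (t * (‖Matrix.toEuclideanLin H z‖ ^ 2 - H.trace))) (stdGaussian _) ∧
    ∫ z : EuclideanSpace ℝ (Fin n), Real.exp (t * (‖Matrix.toEuclideanLin H z‖ ^ 2 - H.trace))
      ∂(stdGaussian _) ≤ Real.exp (2 * t ^ 2 * H.trace) := by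
  obtain ⟨u, a, ha, htr, hD⟩ := exists_eigenbasis hH
  have hm : Measurable (fun z : EuclideanSpace ℝ (Fin n) ↦
      Real.exp (t * (‖Matrix.toEuclideanLin H z‖ ^ 2 - H.trace))) :=
    (measurable_norm_sq_sub_trace.const_mul t).exp
  have hta : ∀ i, |t * a i| ≤ 1 / 4 := fun i ↦ by
    rcases ha i with h | h
    · simp [h]
    · simpa [h] using ht
  have hprod : ∀ x : Fin n → ℝ,
      Real.exp (t * (‖Matrix.toEuclideanLin H (∑ i, x i • u i)‖ ^ 2 - H.trace)) =
        ∏ i, Real.exp (t * a i * (x i ^ 2 - 1)) := fun x ↦ by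
    rw [hD, Finset.mul_sum, Real.exp_sum]
    simp only [mul_assoc]
  rw [stdGaussian_eq_map_pi_orthonormalBasis u, integral_map
    (Measurable.aemeasurable (by fun_prop))
    hm.aestronglyMeasurable, integrable_map_measure hm.aestronglyMeasurable
    (Measurable.aemeasurable (by fun_prop))]
  simp only [Function.comp_def, hprod]
  constructor
  · exact Integrable.fintype_prod (f := fun i x ↦ Real.exp (t * a i * (x ^ 2 - 1)))
      fun i ↦ integrable_exp_mul_sq_sub_one_gaussianReal (by linarith [(abs_le.1 (hta i)).2])
  · rw [integral_fintype_prod_eq_prod (f := fun i x ↦ Real.exp (t * a i * (x ^ 2 - 1))), htr,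
      Finset.mul_sum, Real.exp_sum]
    refine Finset.prod_le_prod (fun i _ ↦ integral_nonneg fun _ ↦ (Real.exp_pos _).le) fun i _ ↦ ?_
    refine (integral_exp_mul_sq_sub_one_gaussianReal_le (hta i)).trans_eq ?_
    rcases ha i with h | h <;> simp [h]

lemma map_inner_stdGaussian (b : EuclideanSpace ℝ (Fin n)) :
    (stdGaussian (EuclideanSpace ℝ (Fin n))).map (fun z ↦ inner ℝ b z) =
      gaussianReal 0 (‖b‖ ^ 2).toNNReal := by
  have h := IsGaussian.map_eq_gaussianReal (μ := stdGaussian (EuclideanSpace ℝ (Fin n)))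
    (innerSL ℝ b)
  rw [variance_dual_stdGaussian, integral_strongDual_stdGaussian, innerSL_apply_norm] at h
  exact h

lemma integrable_inner_stdGaussian (b : EuclideanSpace ℝ (Fin n)) :
    Integrable (fun z ↦ inner ℝ b z) (stdGaussian (EuclideanSpace ℝ (Fin n))) :=
  (innerSL ℝ b).integrable_comp IsGaussian.integrable_id

lemma exp_inner_stdGaussian (b : EuclideanSpace ℝ (Fin n)) (t : ℝ) :
    Integrable (fun z ↦ Real.exp (t * inner ℝ b z)) (stdGaussian (EuclideanSpace ℝ (Fin n))) ∧
    ∫ z, Real.exp (t * inner ℝ b z) ∂(stdGaussian (EuclideanSpace ℝ (Fin n))) =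
      Real.exp (t ^ 2 * ‖b‖ ^ 2 / 2) := by
  constructor
  · have h := integrable_exp_mul_gaussianReal (μ := 0) (v := (‖b‖ ^ 2).toNNReal) t
    rw [← map_inner_stdGaussian b, integrable_map_measure (by fun_prop) (by fun_prop)] at h
    exact h
  · have h := mgf_gaussianReal (map_inner_stdGaussian b) t
    rw [mgf, Real.coe_toNNReal _ (sq_nonneg _)] at h
    rw [h]
    congr 1
    ring

end Projection

/-! ### The risk of the tuned estimator -/

section Risk

variable {n : ℕ} {S : Type*} {H : Matrix (Fin n) (Fin n) ℝ}

lemma inner_residual_toEuclideanLin (hH : IsStarProjection H) (x z : EuclideanSpace ℝ (Fin n)) :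
    inner ℝ (x - Matrix.toEuclideanLin H x) (Matrix.toEuclideanLin H z) = 0 := by
  rw [← isSymmetric_toEuclideanLin hH, map_sub, toEuclideanLin_idem hH, sub_self, inner_zero_left]

/-- Bias–variance decomposition of the loss; the cross term vanishes because the bias is orthogonal
to the range of `H`. -/
lemma norm_linearEstimator_sub_sq (hH : IsStarProjection H) (θ z : EuclideanSpace ℝ (Fin n))
    (σ : ℝ) :
    ‖linearEstimator H (θ + σ • z) - θ‖ ^ 2 =
      ‖θ - Matrix.toEuclideanLin H θ‖ ^ 2 + σ ^ 2 * H.trace +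
        σ ^ 2 * (‖Matrix.toEuclideanLin H z‖ ^ 2 - H.trace) := by
  have h : linearEstimator H (θ + σ • z) - θ =
      -((θ - Matrix.toEuclideanLin H θ) - σ • Matrix.toEuclideanLin H z) := by
    rw [linearEstimator, map_add, map_smul]
    abel
  rw [h, norm_neg, norm_sub_sq_real, inner_smul_right, inner_residual_toEuclideanLin hH,
    norm_smul, mul_pow, Real.norm_eq_abs, sq_abs]
  ring

/-- Up to the term `σ² ‖z‖²`, which is common to all smoothers, SURE is the risk plus two centred
fluctuations, one linear and one quadratic in the noise. -/
lemma sure_add_smul (hH : IsStarProjection H) (θ z : EuclideanSpace ℝ (Fin n)) (σ : ℝ) :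
    sure σ H (θ + σ • z) =
      ‖θ - Matrix.toEuclideanLin H θ‖ ^ 2 + σ ^ 2 * H.trace +
        2 * σ * inner ℝ (θ - Matrix.toEuclideanLin H θ) z -
        σ ^ 2 * (‖Matrix.toEuclideanLin H z‖ ^ 2 - H.trace) + σ ^ 2 * ‖z‖ ^ 2 := by
  have h : θ + σ • z - linearEstimator H (θ + σ • z) =
      (θ - Matrix.toEuclideanLin H θ) + σ • (z - Matrix.toEuclideanLin H z) := by
    rw [linearEstimator, map_add, map_smul, smul_sub]
    abel
  have h2 : inner ℝ z (Matrix.toEuclideanLin H z) = ‖Matrix.toEuclideanLin H z‖ ^ 2 := by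
    rw [← real_inner_self_eq_norm_sq, isSymmetric_toEuclideanLin hH, toEuclideanLin_idem hH]
  rw [sure, h, norm_add_sq_real, inner_smul_right, inner_sub_right,
    inner_residual_toEuclideanLin hH, norm_smul, mul_pow, Real.norm_eq_abs, sq_abs,
    norm_sub_sq_real z, h2]
  ring

lemma continuous_linearEstimator : Continuous (linearEstimator H) :=
  LinearMap.continuous_of_finiteDimensional (Matrix.toEuclideanLin H)

lemma risk_eq_integral_stdGaussian {θ : EuclideanSpace ℝ (Fin n)} {σ : ℝ} (hσ : 0 < σ)
    {est : EuclideanSpace ℝ (Fin n) → EuclideanSpace ℝ (Fin n)} (hest : HasFiniteRisk θ σ est) :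
    risk θ σ est = ∫ z, ‖est (θ + σ • z) - θ‖ ^ 2 ∂(stdGaussian _) := by
  have h := hest.aestronglyMeasurable
  rw [gaussianSequenceLaw_eq_map θ hσ] at h
  rw [risk, gaussianSequenceLaw_eq_map θ hσ, integral_map (by fun_prop) h]

lemma hasFiniteRisk_linearEstimator (hH : IsStarProjection H) (θ : EuclideanSpace ℝ (Fin n))
    {σ : ℝ} (hσ : 0 < σ) : HasFiniteRisk θ σ (linearEstimator H) := by
  have hc := continuous_linearEstimator (H := H)
  rw [HasFiniteRisk, gaussianSequenceLaw_eq_map θ hσ,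
    integrable_map_measure (by fun_prop) (by fun_prop)]
  simp only [Function.comp_def, norm_linearEstimator_sub_sq hH]
  exact (integrable_const _).add ((integrable_norm_sq_sub_trace hH).const_mul _)

lemma risk_linearEstimator (hH : IsStarProjection H) (θ : EuclideanSpace ℝ (Fin n))
    {σ : ℝ} (hσ : 0 < σ) :
    risk θ σ (linearEstimator H) = ‖θ - Matrix.toEuclideanLin H θ‖ ^ 2 + σ ^ 2 * H.trace := by
  rw [risk_eq_integral_stdGaussian hσ (hasFiniteRisk_linearEstimator hH θ hσ)]
  simp only [norm_linearEstimator_sub_sq hH]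
  rw [integral_add (integrable_const _) ((integrable_norm_sq_sub_trace hH).const_mul _),
    integral_const_mul, integral_norm_sq_sub_trace hH]
  simp

variable [Fintype S] {H : S → Matrix (Fin n) (Fin n) ℝ}
  {sel : EuclideanSpace ℝ (Fin n) → S} {θ : EuclideanSpace ℝ (Fin n)} {σ : ℝ}

lemma hasFiniteRisk_tunedEstimator (hH : ∀ s, IsStarProjection (H s)) (hσ : 0 < σ)
    (hsel : IsSureMinimizer σ H sel) : HasFiniteRisk θ σ (tunedEstimator H sel) :=
  integrable_comp_sel (X := fun s y ↦ ‖linearEstimator (H s) y - θ‖ ^ 2)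
    hsel.measurableSet_preimage fun s ↦ hasFiniteRisk_linearEstimator (hH s) θ hσ

/-- The oracle inequality with a free parameter `t`, from which both parts of the theorem follow by
choosing `t`. -/
theorem risk_tunedEstimator_le [Nonempty S] (hH : ∀ s, IsStarProjection (H s)) (hσ : 0 < σ)
    (hsel : IsSureMinimizer σ H sel) (s₀ : S) {t : ℝ} (ht : 0 < t) (ht' : t ≤ 1 / 4) :
    risk θ σ (tunedEstimator H sel) ≤
      (1 + 8 * t) * risk θ σ (linearEstimator (H s₀)) +
        10 * (σ ^ 2 * Real.log (Fintype.card S) / t) := by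
  set P := stdGaussian (EuclideanSpace ℝ (Fin n))
  set L := Real.log (Fintype.card S)
  have hL : 0 ≤ L := Real.log_natCast_nonneg _
  -- `B s + σ ^ 2 * V s` is the risk of the smoother `s`, split into squared bias and variance;
  -- `D s` and `G s` are its fluctuations, and `k z` is the index selected at `y = θ + σ • z`.
  let B : S → ℝ := fun s ↦ ‖θ - Matrix.toEuclideanLin (H s) θ‖ ^ 2
  let V : S → ℝ := fun s ↦ (H s).trace
  let D : S → EuclideanSpace ℝ (Fin n) → ℝ := fun s z ↦
    ‖Matrix.toEuclideanLin (H s) z‖ ^ 2 - (H s).trace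
  let G : S → EuclideanSpace ℝ (Fin n) → ℝ := fun s z ↦
    inner ℝ (θ - Matrix.toEuclideanLin (H s) θ) z
  let k : EuclideanSpace ℝ (Fin n) → S := fun z ↦ sel (θ + σ • z)
  have hk : ∀ s, MeasurableSet (k ⁻¹' {s}) := fun s ↦
    (show Measurable fun z : EuclideanSpace ℝ (Fin n) ↦ θ + σ • z by fun_prop)
      (hsel.measurableSet_preimage s)
  have hB : ∀ s, 0 ≤ B s := fun s ↦ sq_nonneg _
  have hV : ∀ s, 0 ≤ V s := fun s ↦ trace_nonneg_of_isStarProjection (hH s)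
  have hDi : ∀ s, Integrable (D s) P := fun s ↦ integrable_norm_sq_sub_trace (hH s)
  have hGi : ∀ s, Integrable (G s) P := fun s ↦ integrable_inner_stdGaussian _
  have iB : Integrable (fun z ↦ B (k z)) P :=
    integrable_comp_sel (X := fun s _ ↦ B s) hk fun s ↦ integrable_const _
  have iV : Integrable (fun z ↦ V (k z)) P :=
    integrable_comp_sel (X := fun s _ ↦ V s) hk fun s ↦ integrable_const _
  have iD : Integrable (fun z ↦ D (k z) z) P := integrable_comp_sel hk hDi
  have iG : Integrable (fun z ↦ G (k z) z) P := integrable_comp_sel hk hGi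
  have hB0 : 0 ≤ ∫ z, B (k z) ∂P := integral_nonneg fun z ↦ hB _
  have hV0 : 0 ≤ ∫ z, V (k z) ∂P := integral_nonneg fun z ↦ hV _
  -- The maximal inequality for `t * D s`, compensated by its log-Laplace bound.
  have boundD : t * ∫ z, D (k z) z ∂P ≤ 2 * t ^ 2 * ∫ z, V (k z) ∂P + L := by
    have h := integral_comp_sel_le_log_card (P := P)
      (X := fun s z ↦ t * D s z - 2 * t ^ 2 * V s) hk
      (fun s ↦ ((hDi s).const_mul t).sub (integrable_const _))
    simp only [Real.exp_sub] at h
    have hb := fun s ↦ exp_norm_sq_sub_trace_bound (hH s) (t := t) (by rwa [abs_of_pos ht])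
    specialize h (fun s ↦ (hb s).1.div_const _) fun s ↦ by
      rw [integral_div, div_le_one (Real.exp_pos _)]
      exact (hb s).2
    rw [integral_sub (iD.const_mul t) (iV.const_mul _), integral_const_mul,
      integral_const_mul] at h
    linarith
  -- The same for `-G s`, where `t / σ` makes the compensator `t ^ 2 / 2` times `B s / σ ^ 2`.
  have boundG : -(t / σ) * ∫ z, G (k z) z ∂P ≤ (t / σ) ^ 2 / 2 * ∫ z, B (k z) ∂P + L := by
    have h := integral_comp_sel_le_log_card (P := P)
      (X := fun s z ↦ -(t / σ) * G s z - (t / σ) ^ 2 / 2 * B s) hk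
      (fun s ↦ ((hGi s).const_mul _).sub (integrable_const _))
    simp only [Real.exp_sub] at h
    have hb := fun s ↦ exp_inner_stdGaussian (θ - Matrix.toEuclideanLin (H s) θ) (-(t / σ))
    specialize h (fun s ↦ (hb s).1.div_const _) fun s ↦ by
      rw [integral_div, div_le_one (Real.exp_pos _)]
      refine ((hb s).2.trans ?_).le
      congr 1
      simp only [B]
      ring
    rw [integral_sub (iG.const_mul _) (iB.const_mul _), integral_const_mul,
      integral_const_mul] at h
    linarith
  have iBV : Integrable (fun z ↦ B (k z) + σ ^ 2 * V (k z)) P := iB.add (iV.const_mul _)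
  -- SURE at the selected index is at most SURE at `s₀`, whose fluctuations have mean zero.
  have hmin : ∫ z, B (k z) ∂P + σ ^ 2 * ∫ z, V (k z) ∂P + 2 * σ * ∫ z, G (k z) z ∂P -
      σ ^ 2 * ∫ z, D (k z) z ∂P ≤ risk θ σ (linearEstimator (H s₀)) := by
    have iBVG : Integrable (fun z ↦ B (k z) + σ ^ 2 * V (k z) + 2 * σ * G (k z) z) P :=
      iBV.add (iG.const_mul _)
    have iG₀ : Integrable (fun z ↦ B s₀ + σ ^ 2 * V s₀ + 2 * σ * G s₀ z) P :=
      (integrable_const _).add ((hGi s₀).const_mul _)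
    have h : ∫ z, (B (k z) + σ ^ 2 * V (k z) + 2 * σ * G (k z) z - σ ^ 2 * D (k z) z) ∂P ≤
        ∫ z, (B s₀ + σ ^ 2 * V s₀ + 2 * σ * G s₀ z - σ ^ 2 * D s₀ z) ∂P := by
      refine integral_mono (iBVG.sub (iD.const_mul _)) (iG₀.sub ((hDi s₀).const_mul _))
        fun z ↦ ?_
      have h := hsel.sure_le (θ + σ • z) s₀
      rw [sure_add_smul (hH _), sure_add_smul (hH _)] at h
      exact le_of_add_le_add_right h
    have hD0 : ∫ z, D s₀ z ∂P = 0 := integral_norm_sq_sub_trace (hH s₀)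
    have hG0 : ∫ z, G s₀ z ∂P = 0 :=
      integral_strongDual_stdGaussian (innerSL ℝ (θ - Matrix.toEuclideanLin (H s₀) θ))
    rw [integral_sub iBVG (iD.const_mul _), integral_add iBV (iG.const_mul _),
      integral_add iB (iV.const_mul _), integral_sub iG₀ ((hDi s₀).const_mul _),
      integral_add (integrable_const _) ((hGi s₀).const_mul _)] at h
    simp only [integral_const_mul, hD0, hG0] at h
    rw [risk_linearEstimator (hH s₀) θ hσ]
    simpa using h
  have hrisk : risk θ σ (tunedEstimator H sel) =
      ∫ z, B (k z) ∂P + σ ^ 2 * ∫ z, V (k z) ∂P + σ ^ 2 * ∫ z, D (k z) z ∂P := by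
    rw [risk_eq_integral_stdGaussian hσ (hasFiniteRisk_tunedEstimator hH hσ hsel),
      ← integral_const_mul, ← integral_const_mul, ← integral_add iB (iV.const_mul _),
      ← integral_add iBV (iD.const_mul _)]
    exact integral_congr_ae (ae_of_all _ fun z ↦ norm_linearEstimator_sub_sq (hH _) θ z σ)
  rw [hrisk]
  have hR₀ : 0 ≤ risk θ σ (linearEstimator (H s₀)) := integral_nonneg fun _ ↦ sq_nonneg _
  generalize risk θ σ (linearEstimator (H s₀)) = R₀ at *
  set EB := ∫ z, B (k z) ∂P
  set EV := ∫ z, V (k z) ∂P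
  set ED := ∫ z, D (k z) z ∂P
  set EG := ∫ z, G (k z) z ∂P
  set K := σ ^ 2 * L / t with hK
  have hK0 : 0 ≤ K := by positivity
  have hKt : K * t = σ ^ 2 * L := by rw [hK]; field_simp
  have bD : σ ^ 2 * ED ≤ 2 * t * (σ ^ 2 * EV) + K := by
    have h := mul_le_mul_of_nonneg_left boundD (sq_nonneg σ)
    refine le_of_mul_le_mul_right ?_ ht
    linarith
  have bG : -(σ * EG) ≤ t / 2 * EB + K := by
    have h := mul_le_mul_of_nonneg_left boundG (sq_nonneg σ)
    have e1 : σ ^ 2 * (-(t / σ) * EG) = -(σ * EG) * t := by field_simp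
    have e2 : σ ^ 2 * ((t / σ) ^ 2 / 2 * EB + L) = (t / 2 * EB) * t + K * t := by
      rw [hKt]; field_simp
    rw [e1, e2, ← add_mul] at h
    exact le_of_mul_le_mul_right h ht
  have hW : 0 ≤ σ ^ 2 * EV := by positivity
  -- Absorb the fluctuations into the expected risk `EB + σ ^ 2 * EV` of the selected smoother.
  have hWρ : t * (σ ^ 2 * EV) ≤ t * (EB + σ ^ 2 * EV) :=
    mul_le_mul_of_nonneg_left (by linarith) ht.le
  have hρ : (1 - 2 * t) * (EB + σ ^ 2 * EV) ≤ R₀ + 3 * K := by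
    linarith [mul_nonneg ht.le hB0]
  have hρ0 : 0 ≤ EB + σ ^ 2 * EV := by linarith
  -- `(1 - 2 * t)⁻¹ ≤ 1 + 4 * t` on `[0, 1 / 4]`.
  have hρ' : EB + σ ^ 2 * EV ≤ (1 + 4 * t) * (R₀ + 3 * K) := by
    have h1 := mul_le_mul_of_nonneg_left hρ (by linarith : 0 ≤ 1 + 4 * t)
    have h2 : 0 ≤ 2 * t * (1 - 4 * t) * (EB + σ ^ 2 * EV) :=
      mul_nonneg (mul_nonneg (by linarith) (by linarith)) hρ0
    linarith
  calc EB + σ ^ 2 * EV + σ ^ 2 * ED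
      ≤ (1 + 2 * t) * (EB + σ ^ 2 * EV) + K := by linarith
    _ ≤ (1 + 2 * t) * ((1 + 4 * t) * (R₀ + 3 * K)) + K := by gcongr
    _ = (1 + 8 * t) * R₀ + 10 * K -
          (1 - 4 * t) * (2 * t * R₀ + 3 * (2 + 2 * t) * K) := by ring
    _ ≤ (1 + 8 * t) * R₀ + 10 * K :=
        sub_le_self _ (mul_nonneg (by linarith) (by positivity))

end Risk

/-! ### Choice of the parameter -/

/-- Minimizing the family of bounds in `risk_tunedEstimator_le` over `t`: with `R` the oracle risk
and `K = σ² log |S|`, the choices are `t = √(K / R)` when this is at most `1 / 4`, and `t = 1 / 4`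
otherwise. -/
lemma le_add_sqrt_of_forall_le {r R K : ℝ} (hR : 0 ≤ R) (hK : 0 ≤ K)
    (h : ∀ t : ℝ, 0 < t → t ≤ 1 / 4 → r ≤ (1 + 8 * t) * R + 10 * (K / t)) :
    r ≤ R + 72 * (√(R * K) + K) := by
  rcases hK.eq_or_lt with rfl | hK'
  · -- Without a selection cost, `t` may tend to `0`.
    simp only [zero_div, mul_zero, add_zero, Real.sqrt_zero] at h ⊢
    refine le_of_forall_pos_le_add fun ε hε ↦ ?_
    have hpos : 0 < min (1 / 4) (ε / (8 * (R + 1))) := lt_min (by norm_num) (by positivity)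
    have h1 := h _ hpos (min_le_left _ _)
    have h2 : 8 * (R + 1) * min (1 / 4) (ε / (8 * (R + 1))) ≤ ε := by
      rw [mul_comm]
      exact (le_div_iff₀ (by positivity)).1 (min_le_right _ _)
    linarith
  have hs : 0 ≤ √(R * K) := Real.sqrt_nonneg _
  rcases le_total (16 * K) R with hc | hc
  · -- `t = √(K / R)` balances the two error terms.
    have hR' : 0 < R := by linarith
    have hRK : 0 < √(R * K) := Real.sqrt_pos.2 (mul_pos hR' hK')
    have hsq : √(R * K) * √(R * K) = R * K := Real.mul_self_sqrt (by positivity)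
    have h1 := h (√(R * K) / R) (by positivity) (by
      rw [div_le_iff₀ hR', Real.sqrt_le_left (by positivity)]
      nlinarith)
    have e1 : (1 + 8 * (√(R * K) / R)) * R = R + 8 * √(R * K) := by field_simp
    have e2 : K / (√(R * K) / R) = √(R * K) := by
      rw [div_div_eq_mul_div, div_eq_iff hRK.ne', hsq, mul_comm]
    rw [e1, e2] at h1
    linarith
  · have h1 := h (1 / 4) (by norm_num) le_rfl
    linarith

theorem mainTheorem2 :
    (∃ C : ℝ, 0 < C ∧
      ∀ (n : ℕ) (S : Type*) [Fintype S] [Nonempty S]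
        (H : S → Matrix (Fin n) (Fin n) ℝ) (_ : ∀ s, IsStarProjection (H s))
        (θ₀ : EuclideanSpace ℝ (Fin n)) (σ : ℝ) (_ : 0 < σ)
        (sel : EuclideanSpace ℝ (Fin n) → S) (_ : IsSureMinimizer σ H sel)
        (s₀ : S)
        (_ : ∀ s, risk θ₀ σ (linearEstimator (H s₀)) ≤ risk θ₀ σ (linearEstimator (H s))),
        (∀ s, HasFiniteRisk θ₀ σ (linearEstimator (H s))) ∧
        HasFiniteRisk θ₀ σ (tunedEstimator H sel) ∧
        risk θ₀ σ (tunedEstimator H sel) ≤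
          risk θ₀ σ (linearEstimator (H s₀)) +
            C * (√(risk θ₀ σ (linearEstimator (H s₀)) * (σ ^ 2 * Real.log (Fintype.card S))) +
              σ ^ 2 * Real.log (Fintype.card S) *
                (1 + Real.posLog (σ ^ 2 * Real.log (Fintype.card S) /
                  risk θ₀ σ (linearEstimator (H s₀)))))) ∧
    (∀ c : ℝ, 0 < c → ∃ C : ℝ, 0 < C ∧
      ∀ (n : ℕ) (S : Type*) [Fintype S] [Nonempty S]
        (H : S → Matrix (Fin n) (Fin n) ℝ) (_ : ∀ s, IsStarProjection (H s))
        (θ₀ : EuclideanSpace ℝ (Fin n)) (σ : ℝ) (_ : 0 < σ)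
        (sel : EuclideanSpace ℝ (Fin n) → S) (_ : IsSureMinimizer σ H sel)
        (_ : c * (σ ^ 2 * Real.log (Fintype.card S)) ≤
          ⨅ s, risk θ₀ σ (linearEstimator (H s)))
        (η : ℝ) (_ : 0 < η),
        risk θ₀ σ (tunedEstimator H sel) ≤
          (1 + C * η) * (⨅ s, risk θ₀ σ (linearEstimator (H s))) +
            C * (σ ^ 2 * Real.log (Fintype.card S) / η)) := by
  refine ⟨⟨72, by norm_num, ?_⟩, fun c hc ↦ ⟨10 + 160 / c, by positivity, ?_⟩⟩
  · intro n S _ _ H hH θ₀ σ hσ sel hsel s₀ _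
    refine ⟨fun s ↦ hasFiniteRisk_linearEstimator (hH s) θ₀ hσ,
      hasFiniteRisk_tunedEstimator hH hσ hsel, ?_⟩
    have hK : 0 ≤ σ ^ 2 * Real.log (Fintype.card S) :=
      mul_nonneg (sq_nonneg _) (Real.log_natCast_nonneg _)
    have hR : 0 ≤ risk θ₀ σ (linearEstimator (H s₀)) := integral_nonneg fun _ ↦ sq_nonneg _
    refine (le_add_sqrt_of_forall_le hR hK
      fun t ht ht' ↦ risk_tunedEstimator_le hH hσ hsel s₀ ht ht').trans ?_
    have hlog := le_mul_of_one_le_right hK (le_add_of_nonneg_right (Real.posLog_nonneg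
      (x := σ ^ 2 * Real.log (Fintype.card S) / risk θ₀ σ (linearEstimator (H s₀)))))
    linarith
  · intro n S _ _ H hH θ₀ σ hσ sel hsel hmin η hη
    obtain ⟨s₀, hs₀⟩ := exists_eq_ciInf_of_finite (f := fun s ↦ risk θ₀ σ (linearEstimator (H s)))
    rw [← hs₀] at hmin ⊢
    have hR : 0 ≤ risk θ₀ σ (linearEstimator (H s₀)) := integral_nonneg fun _ ↦ sq_nonneg _
    have hK : 0 ≤ σ ^ 2 * Real.log (Fintype.card S) :=
      mul_nonneg (sq_nonneg _) (Real.log_natCast_nonneg _)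
    have key := fun t ht ht' ↦ risk_tunedEstimator_le hH hσ hsel (θ := θ₀) s₀ (t := t) ht ht'
    generalize risk θ₀ σ (linearEstimator (H s₀)) = R at *
    generalize σ ^ 2 * Real.log (Fintype.card S) = K at *
    have hc' : 0 ≤ 160 / c := by positivity
    rcases le_total η (1 / 4) with h | h
    · refine (key η hη h).trans ?_
      gcongr <;> linarith
    · -- Here `K ≤ R / c`, so the whole error is at most a multiple of `R ≤ 4 * η * R`.
      have h1 := key (1 / 4) (by norm_num) le_rfl
      have h2 : 40 * K ≤ 40 / c * R := by
        rw [div_mul_eq_mul_div, le_div_iff₀ hc]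
        linarith
      have h3 : 0 ≤ (10 + 160 / c) * (K / η) := by positivity
      have h4 : (10 + 160 / c) * R * (1 / 4) ≤ (10 + 160 / c) * R * η := by gcongr
      have h5 : 40 / c = 160 / c * (1 / 4) := by ring
      rw [h5] at h2
      linarith
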